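/- Let $R=R_0\oplus R_1$ be a super ring, that is, an associative unital $\mathbb{Z}_2$-graded ring (not necessarily commutative). For a super ring $A$ let $\mathfrak{M}_A$ (resp. ${}_A\mathfrak{M}$) be the category whose objects are the $\mathbb{Z}_2$-graded right (resp. left) $A$-modules $M=M_0\oplus M_1$ with $M_iA_j\subseteq M_{i+j}$ (resp. $A_jM_i\subseteq M_{i+j}$) and whose morphisms are the parity-preserving $A$-module homomorphisms; the set of morphisms is denoted $\mathrm{Hom}_A(M,N)$, while $\underline{\mathrm{Hom}}_A(M,N)$ denotes the group of all $A$-module homomorphisms, $\mathbb{Z}_2$-graded with even part the parity-preserving and odd part the parity-reversing homomorphisms. A module $P\in\mathfrak{M}_R$ is a progenerator if it is finitely generated, projective (the functor $\mathrm{Hom}_R(P,-)$ is exact on $\mathfrak{M}_R$) and a generator (the functor $\underline{\mathrm{Hom}}_R(P,-)$ is faithful on $\mathfrak{M}_R$). Let $P\in\mathfrak{M}_R$ be a progenerator, let $S=\underline{\mathrm{End}}_R(P)$, a super ring under composition acting on $P$ on the left, so that $P$ is an $(S,R)$-bimodule, and let $Q=P^*=\underline{\mathrm{Hom}}_R(P,R)$,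 which is an $(R,S)$-bimodule through $(rq)(p)=r(q(p))$ and $(qs)(p)=q(s(p))$. Tensor products carry the grading in which the degree $k$ part is generated by the $m\otimes n$ with $m$ of degree $i$, $n$ of degree $j$ and $i+j=k$, and the module structure induced by that of the bimodule factor. Then: 1. the functors $-\otimes_R Q:\mathfrak{M}_R\to\mathfrak{M}_S$ and $-\otimes_S P:\mathfrak{M}_S\to\mathfrak{M}_R$ are mutually inverse equivalences of categories; 2. the functors $P\otimes_R-:{}_R\mathfrak{M}\to{}_S\mathfrak{M}$ and $Q\otimes_S-:{}_S\mathfrak{M}\to{}_R\mathfrak{M}$ are mutually inverse equivalences of categories. -/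

import Mathlib

open CategoryTheory MulOpposite
open scoped TensorProduct

universe u

noncomputable section

/-! ### Gradings by `ZMod 2` -/

section Grading

variable {M : Type*} [AddCommGroup M] {𝓜 : ZMod 2 → AddSubgroup M}

/-- A family of homogeneous projections exhibits an internal direct sum. -/
theorem isInternal_of_proj (p : ZMod 2 → M →+ M) (hmem : ∀ k x, p k x ∈ 𝓜 k)
    (hsame : ∀ k x, x ∈ 𝓜 k → p k x = x)
    (hne : ∀ j k x, j ≠ k → x ∈ 𝓜 j → p k x = 0)
    (hsum : ∀ x, ∑ k, p k x = x) : DirectSum.IsInternal 𝓜 := by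
  have key : ∀ (k : ZMod 2) (d : DirectSum (ZMod 2) fun i => 𝓜 i),
      p k (DirectSum.coeAddMonoidHom 𝓜 d) = d k := by
    intro k d
    induction d using DirectSum.induction_on with
    | zero => simp
    | of i x =>
      rw [DirectSum.coeAddMonoidHom_of]
      by_cases h : i = k
      · subst h
        simp [hsame i x x.2]
      · rw [hne i k x h x.2, DirectSum.of_eq_of_ne _ _ _ (Ne.symm h)]
        rfl
    | add x y hx hy => simp [hx, hy]
  constructor
  · intro d e h
    ext k
    rw [← key, ← key]
    exact congrArg (p k) h
  · intro x
    refine ⟨∑ k, DirectSum.of (fun i => 𝓜 i) k ⟨p k x, hmem k x⟩, ?_⟩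
    rw [map_sum]
    simp only [DirectSum.coeAddMonoidHom_of]
    exact hsum x

/-- The projection onto the homogeneous component of degree `k`. -/
def gradeProj (h : DirectSum.IsInternal 𝓜) (k : ZMod 2) : M →+ M :=
  letI := h.chooseDecomposition
  { toFun := fun x => (DirectSum.decompose 𝓜 x k : M)
    map_zero' := by simp
    map_add' := fun x y => by simp }

theorem gradeProj_mem (h : DirectSum.IsInternal 𝓜) (k : ZMod 2) (x : M) :
    gradeProj h k x ∈ 𝓜 k := by
  let _ := h.chooseDecomposition
  exact (DirectSum.decompose 𝓜 x k).2

theorem gradeProj_same (h : DirectSum.IsInternal 𝓜) {k : ZMod 2} {x : M} (hx : x ∈ 𝓜 k) :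
    gradeProj h k x = x := by
  let _ := h.chooseDecomposition
  exact DirectSum.decompose_of_mem_same 𝓜 hx

theorem gradeProj_ne (h : DirectSum.IsInternal 𝓜) {j k : ZMod 2} {x : M} (hx : x ∈ 𝓜 j)
    (hjk : j ≠ k) : gradeProj h k x = 0 := by
  let _ := h.chooseDecomposition
  exact DirectSum.decompose_of_mem_ne 𝓜 hx hjk

theorem grade_induction (h : DirectSum.IsInternal 𝓜) {C : M → Prop} (x : M)
    (hom : ∀ i x, x ∈ 𝓜 i → C x) (hadd : ∀ x y, C x → C y → C (x + y)) : C x := by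
  let _ := h.chooseDecomposition
  exact DirectSum.Decomposition.inductionOn 𝓜 (hom 0 0 (zero_mem _))
    (fun {i} m => hom i m m.2) hadd x

theorem sum_gradeProj (h : DirectSum.IsInternal 𝓜) (x : M) : ∑ k, gradeProj h k x = x := by
  induction x using grade_induction h with
  | hom i x hx =>
    rw [Finset.sum_eq_single i (fun j _ hj => gradeProj_ne h hx hj.symm) (by simp),
      gradeProj_same h hx]
  | hadd x y hx hy => simp only [map_add, Finset.sum_add_distrib, hx, hy]

end Grading

/-- The opposite ring (a right module is a module over it), graded by the same subgroups.
There is no sign here: this is the plain opposite ring. -/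
def opGrading {R : Type*} [Ring R] (𝓡 : ZMod 2 → AddSubgroup R) : ZMod 2 → AddSubgroup Rᵐᵒᵖ :=
  fun k => (𝓡 k).comap (MulOpposite.opAddEquiv (α := R)).symm.toAddMonoidHom

theorem mem_opGrading {R : Type*} [Ring R] {𝓡 : ZMod 2 → AddSubgroup R} {k : ZMod 2}
    {a : Rᵐᵒᵖ} : a ∈ opGrading 𝓡 k ↔ unop a ∈ 𝓡 k := Iff.rfl

theorem opGrading_isInternal {R : Type*} [Ring R] {𝓡 : ZMod 2 → AddSubgroup R}
    (h : DirectSum.IsInternal 𝓡) : DirectSum.IsInternal (opGrading 𝓡) := by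
  refine isInternal_of_proj (fun k => (MulOpposite.opAddEquiv (α := R)).toAddMonoidHom.comp
    ((gradeProj h k).comp (MulOpposite.opAddEquiv (α := R)).symm.toAddMonoidHom))
    (fun k x => gradeProj_mem h k (unop x)) ?_ ?_ ?_
  · intro k x hx
    exact congrArg op (gradeProj_same h (mem_opGrading.1 hx))
  · intro j k x hjk hx
    exact congrArg op (gradeProj_ne h (mem_opGrading.1 hx) hjk)
  · intro x
    have := congrArg (MulOpposite.opAddEquiv (α := R)) (sum_gradeProj h (unop x))
    rw [map_sum] at this
    exact this

/-! ### The category of supermodules -/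

/-- A supermodule over a ring `A` graded by `𝒜`: an `A`-module `M = M₀ ⊕ M₁` with
`Aᵢ Mⱼ ⊆ Mᵢ₊ⱼ`. -/
structure SuperMod {A : Type u} [Ring A] (𝒜 : ZMod 2 → AddSubgroup A) where
  carrier : Type u
  [addCommGroup : AddCommGroup carrier]
  [module : Module A carrier]
  grading : ZMod 2 → AddSubgroup carrier
  isInternal : DirectSum.IsInternal grading
  smul_mem : ∀ {i j : ZMod 2} {a : A} {m : carrier}, a ∈ 𝒜 i → m ∈ grading j →
    a • m ∈ grading (i + j)

namespace SuperMod

variable {A : Type u} [Ring A] {𝒜 : ZMod 2 → AddSubgroup A}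

instance : CoeSort (SuperMod 𝒜) (Type u) := ⟨SuperMod.carrier⟩

attribute [instance] SuperMod.addCommGroup SuperMod.module

/-- A morphism of supermodules: a parity-preserving linear map. -/
@[ext]
structure Hom (M N : SuperMod 𝒜) where
  toLin : M →ₗ[A] N
  map_mem : ∀ (i : ZMod 2) (m : M), m ∈ M.grading i → toLin m ∈ N.grading i

instance : Category (SuperMod 𝒜) where
  Hom M N := Hom M N
  id M := ⟨LinearMap.id, fun _ _ h => h⟩
  comp f g := ⟨g.toLin ∘ₗ f.toLin, fun i m h => g.map_mem i _ (f.map_mem i m h)⟩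

instance (M N : SuperMod 𝒜) : Zero (M ⟶ N) := ⟨⟨0, fun i _ _ => zero_mem (N.grading i)⟩⟩

/-- `P` is projective if the functor `Hom(P, -)` of parity-preserving homomorphisms carries
short exact sequences of supermodules to short exact sequences. -/
def IsProjective (P : SuperMod 𝒜) : Prop :=
  ∀ (X Y Z : SuperMod 𝒜) (f : X ⟶ Y) (g : Y ⟶ Z),
    Function.Injective f.toLin → Function.Exact f.toLin g.toLin →
    Function.Surjective g.toLin →
      Function.Injective (fun h : P ⟶ X => h ≫ f) ∧
      Function.Exact (fun h : P ⟶ X => h ≫ f) (fun h : P ⟶ Y => h ≫ g) ∧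
      Function.Surjective (fun h : P ⟶ Y => h ≫ g)

end SuperMod

/-- Left supermodules over the super ring `R`. -/
abbrev LeftSuperMod {R : Type u} [Ring R] (𝓡 : ZMod 2 → AddSubgroup R) :=
  SuperMod 𝓡

/-- Right supermodules over the super ring `R`. -/
abbrev RightSuperMod {R : Type u} [Ring R] (𝓡 : ZMod 2 → AddSubgroup R) :=
  SuperMod (opGrading 𝓡)

namespace RightSuperMod

variable {R : Type u} [Ring R] {𝓡 : ZMod 2 → AddSubgroup R}

/-- `P` is a generator if the internal Hom functor, of all `R`-linear maps out of `P` whether or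
not they preserve parity, is faithful. -/
def IsGenerator (P : RightSuperMod 𝓡) : Prop :=
  ∀ (M N : RightSuperMod 𝓡) (f : M ⟶ N),
    (∀ g : P →ₗ[Rᵐᵒᵖ] M, f.toLin ∘ₗ g = 0) → f = 0

/-- A progenerator is a finitely generated projective generator. -/
structure IsProgenerator (P : RightSuperMod 𝓡) : Prop where
  finite : Module.Finite Rᵐᵒᵖ P
  projective : SuperMod.IsProjective P
  generator : IsGenerator P

end RightSuperMod

/-! ### The grading of the internal Hom -/

section HomGrading

variable {A : Type*} [Ring A] {M N : Type*} [AddCommGroup M] [Module A M] [AddCommGroup N]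
  [Module A N]

/-- Degree `k` part of the internal Hom: the linear maps `f` with `f Mᵢ ⊆ Nᵢ₊ₖ`. -/
def homGrading (𝓜 : ZMod 2 → AddSubgroup M) (𝓝 : ZMod 2 → AddSubgroup N) :
    ZMod 2 → AddSubgroup (M →ₗ[A] N) := fun k =>
  { carrier := {f | ∀ i, ∀ m ∈ 𝓜 i, f m ∈ 𝓝 (i + k)}
    zero_mem' := fun i _ _ => zero_mem (𝓝 (i + k))
    add_mem' := fun hf hg i m hm => add_mem (hf i m hm) (hg i m hm)
    neg_mem' := fun hf i m hm => neg_mem (hf i m hm) }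

theorem mem_homGrading {𝓜 : ZMod 2 → AddSubgroup M} {𝓝 : ZMod 2 → AddSubgroup N} {k : ZMod 2}
    {f : M →ₗ[A] N} : f ∈ homGrading 𝓜 𝓝 k ↔ ∀ i, ∀ m ∈ 𝓜 i, f m ∈ 𝓝 (i + k) := Iff.rfl

/-- Degree `k` component of a linear map, as an additive map. -/
def homProjAux {𝓜 : ZMod 2 → AddSubgroup M} {𝓝 : ZMod 2 → AddSubgroup N}
    (hM : DirectSum.IsInternal 𝓜) (hN : DirectSum.IsInternal 𝓝) (k : ZMod 2)
    (f : M →ₗ[A] N) : M →+ N :=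
  ∑ i, (gradeProj hN (i + k)).comp (f.toAddMonoidHom.comp (gradeProj hM i))

theorem homProjAux_apply {𝓜 : ZMod 2 → AddSubgroup M} {𝓝 : ZMod 2 → AddSubgroup N}
    (hM : DirectSum.IsInternal 𝓜) (hN : DirectSum.IsInternal 𝓝) (k : ZMod 2)
    (f : M →ₗ[A] N) {i : ZMod 2} {m : M} (hm : m ∈ 𝓜 i) :
    homProjAux hM hN k f m = gradeProj hN (i + k) (f m) := by
  rw [homProjAux, AddMonoidHom.finsetSum_apply, Finset.sum_eq_single i]
  · simp [gradeProj_same hM hm]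
  · intro j _ hj
    simp [gradeProj_ne hM hm hj.symm]
  · simp

theorem gradeProj_smul {𝒜 : ZMod 2 → AddSubgroup A} {𝓝 : ZMod 2 → AddSubgroup N}
    (hN : DirectSum.IsInternal 𝓝)
    (sN : ∀ {i j : ZMod 2} {a : A} {n : N}, a ∈ 𝒜 i → n ∈ 𝓝 j → a • n ∈ 𝓝 (i + j))
    {j k : ZMod 2} {a : A} (ha : a ∈ 𝒜 j) (n : N) :
    gradeProj hN (j + k) (a • n) = a • gradeProj hN k n := by
  induction n using grade_induction hN with
  | hom i n hn =>
    by_cases h : i = k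
    · subst h
      rw [gradeProj_same hN hn, gradeProj_same hN (sN ha hn)]
    · rw [gradeProj_ne hN hn h, gradeProj_ne hN (sN ha hn) (fun e => h (add_left_cancel e)),
        smul_zero]
  | hadd x y hx hy => simp only [smul_add, map_add, hx, hy]

theorem homGrading_isInternal {𝒜 : ZMod 2 → AddSubgroup A} {𝓜 : ZMod 2 → AddSubgroup M}
    {𝓝 : ZMod 2 → AddSubgroup N} (hA : DirectSum.IsInternal 𝒜)
    (hM : DirectSum.IsInternal 𝓜) (hN : DirectSum.IsInternal 𝓝)
    (sM : ∀ {i j : ZMod 2} {a : A} {m : M}, a ∈ 𝒜 i → m ∈ 𝓜 j → a • m ∈ 𝓜 (i + j))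
    (sN : ∀ {i j : ZMod 2} {a : A} {n : N}, a ∈ 𝒜 i → n ∈ 𝓝 j → a • n ∈ 𝓝 (i + j)) :
    DirectSum.IsInternal (homGrading (A := A) 𝓜 𝓝) := by
  have hlin : ∀ (k : ZMod 2) (f : M →ₗ[A] N) (a : A) (m : M),
      homProjAux hM hN k f (a • m) = a • homProjAux hM hN k f m := by
    intro k f a m
    induction a using grade_induction hA with
    | hadd x y hx hy => simp only [add_smul, map_add, hx, hy]
    | hom j a ha =>
      induction m using grade_induction hM with
      | hadd x y hx hy => simp only [smul_add, map_add, hx, hy]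
      | hom i m hm =>
        rw [homProjAux_apply hM hN k f hm, homProjAux_apply hM hN k f (sM ha hm), map_smul,
          add_assoc, gradeProj_smul hN sN ha]
  refine isInternal_of_proj (fun k =>
    { toFun := fun f =>
        { toFun := homProjAux hM hN k f
          map_add' := map_add _
          map_smul' := hlin k f }
      map_zero' := ?_
      map_add' := ?_ }) ?_ ?_ ?_ ?_
  · ext m
    simp [homProjAux]
  · intro f g
    ext m
    simp [homProjAux, Finset.sum_add_distrib]
  · intro k f i m hm
    change homProjAux hM hN k f m ∈ _
    rw [homProjAux_apply hM hN k f hm]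
    exact gradeProj_mem hN _ _
  · intro k f hf
    ext m
    change homProjAux hM hN k f m = f m
    induction m using grade_induction hM with
    | hadd x y hx hy => simp only [map_add, hx, hy]
    | hom i m hm => rw [homProjAux_apply hM hN k f hm, gradeProj_same hN (hf i m hm)]
  · intro j k f hjk hf
    ext m
    change homProjAux hM hN k f m = 0
    induction m using grade_induction hM with
    | hadd x y hx hy => simp only [map_add, hx, hy, add_zero]
    | hom i m hm =>
      rw [homProjAux_apply hM hN k f hm, gradeProj_ne hN (hf i m hm)]
      exact fun e => hjk (add_left_cancel e)
  · intro f
    ext m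
    rw [LinearMap.sum_apply]
    change ∑ k, homProjAux hM hN k f m = f m
    induction m using grade_induction hM with
    | hadd x y hx hy => simp only [map_add, Finset.sum_add_distrib, hx, hy]
    | hom i m hm =>
      simp only [homProjAux_apply hM hN _ f hm]
      exact (Fintype.sum_equiv (Equiv.addLeft i) _ (fun k => gradeProj hN k (f m))
        (fun _ => rfl)).trans (sum_gradeProj hN (f m))

end HomGrading

/-! ### The tensor product over a noncommutative ring -/

section BalTensor

variable (A : Type*) [Ring A] (M N : Type*) [AddCommGroup M] [Module Aᵐᵒᵖ M] [AddCommGroup N]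
  [Module A N]

/-- The relations `m a ⊗ n = m ⊗ a n`. -/
def balRel : Submodule ℤ (M ⊗[ℤ] N) :=
  Submodule.span ℤ {x | ∃ (m : M) (a : A) (n : N), x = (op a • m) ⊗ₜ[ℤ] n - m ⊗ₜ[ℤ] (a • n)}

/-- The tensor product `M ⊗_A N` of a right `A`-module and a left `A`-module, an abelian group. -/
def BalTensor : Type _ := (M ⊗[ℤ] N) ⧸ balRel A M N

instance : AddCommGroup (BalTensor A M N) :=
  inferInstanceAs (AddCommGroup ((M ⊗[ℤ] N) ⧸ balRel A M N))

namespace BalTensor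

variable {M N}

/-- The pure tensor `m ⊗ n`. -/
def tmul (m : M) (n : N) : BalTensor A M N := Submodule.Quotient.mk (m ⊗ₜ[ℤ] n)

theorem add_tmul (m m' : M) (n : N) : tmul A (m + m') n = tmul A m n + tmul A m' n :=
  congrArg (Submodule.Quotient.mk (p := balRel A M N)) (TensorProduct.add_tmul m m' n)

theorem tmul_add (m : M) (n n' : N) : tmul A m (n + n') = tmul A m n + tmul A m n' :=
  congrArg (Submodule.Quotient.mk (p := balRel A M N)) (TensorProduct.tmul_add m n n')

theorem smul_tmul (m : M) (a : A) (n : N) : tmul A (op a • m) n = tmul A m (a • n) :=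
  (Submodule.Quotient.eq (balRel A M N)).2 (Submodule.subset_span ⟨m, a, n, rfl⟩)

/-- The pure tensor as a biadditive map. -/
def tmulHom : M →+ N →+ BalTensor A M N :=
  AddMonoidHom.mk' (fun m => AddMonoidHom.mk' (tmul A m) (tmul_add A m))
    (fun m m' => AddMonoidHom.ext fun n => add_tmul A m m' n)

variable {A}

theorem induction_on {C : BalTensor A M N → Prop} (x : BalTensor A M N)
    (pure : ∀ m n, C (tmul A m n)) (hadd : ∀ x y, C x → C y → C (x + y)) : C x := by
  obtain ⟨y, rfl⟩ := Submodule.Quotient.mk_surjective _ x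
  induction y using TensorProduct.induction_on with
  | zero =>
    have h := pure 0 0
    rwa [tmul, TensorProduct.zero_tmul] at h
  | tmul m n => exact pure m n
  | add x y hx hy => exact hadd _ _ hx hy

variable {G : Type*} [AddCommGroup G]

/-- The universal property. -/
def lift (f : M →+ N →+ G) (hf : ∀ m (a : A) n, f (op a • m) n = f m (a • n)) :
    BalTensor A M N →+ G :=
  ((balRel A M N).liftQ
    (TensorProduct.liftAddHom (R := ℤ) f (fun r m n => by simp)).toIntLinearMap (by
      rw [balRel, Submodule.span_le]
      rintro x ⟨m, a, n, rfl⟩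
      simp [hf])).toAddMonoidHom

@[simp]
theorem lift_tmul (f : M →+ N →+ G) (hf : ∀ m (a : A) n, f (op a • m) n = f m (a • n))
    (m : M) (n : N) : lift f hf (tmul A m n) = f m n := rfl

theorem addHom_ext {f g : BalTensor A M N →+ G} (h : ∀ m n, f (tmul A m n) = g (tmul A m n)) :
    f = g := by
  ext x
  induction x using induction_on with
  | pure m n => exact h m n
  | hadd x y hx hy => rw [map_add, map_add, hx, hy]

variable {M' N' : Type*} [AddCommGroup M'] [Module Aᵐᵒᵖ M'] [AddCommGroup N'] [Module A N']

/-- The map `f ⊗ g` (for `f`, `g` without sign, that is for `g` even). -/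
def map (f : M →ₗ[Aᵐᵒᵖ] M') (g : N →ₗ[A] N') : BalTensor A M N →+ BalTensor A M' N' :=
  lift (((tmulHom A).compl₂ g.toAddMonoidHom).comp f.toAddMonoidHom) (fun m a n => by
    change tmul A (f (op a • m)) (g n) = tmul A (f m) (g (a • n))
    rw [map_smul, map_smul, smul_tmul])

@[simp]
theorem map_tmul (f : M →ₗ[Aᵐᵒᵖ] M') (g : N →ₗ[A] N') (m : M) (n : N) :
    map f g (tmul A m n) = tmul A (f m) (g n) := rfl

/-- A ring `T` acting on `M` and commuting with `A` acts by `t (m ⊗ n) = (t m) ⊗ n`. -/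
@[reducible]
def moduleLeft (T : Type*) [Ring T] [Module T M] [SMulCommClass T Aᵐᵒᵖ M] :
    Module T (BalTensor A M N) where
  smul t x := map (Module.toModuleEnd Aᵐᵒᵖ (S := T) M t) LinearMap.id x
  one_smul x := by
    change map _ _ x = x
    induction x using induction_on with
    | pure m n => simp
    | hadd x y hx hy => rw [map_add, hx, hy]
  mul_smul s t x := by
    change map _ _ x = map _ _ (map _ _ x)
    induction x using induction_on with
    | pure m n => simp [mul_smul]
    | hadd x y hx hy => simp only [map_add, hx, hy]
  smul_zero t := map_zero (map _ _)
  smul_add t x y := map_add (map _ _) x y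
  add_smul s t x := by
    change map _ _ x = map _ _ x + map _ _ x
    induction x using induction_on with
    | pure m n => simp [add_smul, add_tmul]
    | hadd x y hx hy =>
      simp only [map_add] at hx hy ⊢
      rw [hx, hy]
      abel
  zero_smul x := by
    change map _ _ x = 0
    induction x using induction_on with
    | pure m n =>
      have h := add_tmul A (0 : M) 0 n
      rw [add_zero] at h
      simpa using h
    | hadd x y hx hy => simp only [map_add, hx, hy, add_zero]

/-- A ring `T` acting on `N` and commuting with `A` acts by `t (m ⊗ n) = m ⊗ (t n)`. -/
@[reducible]
def moduleRight (T : Type*) [Ring T] [Module T N] [SMulCommClass T A N] :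
    Module T (BalTensor A M N) where
  smul t x := map LinearMap.id (Module.toModuleEnd A (S := T) N t) x
  one_smul x := by
    change map _ _ x = x
    induction x using induction_on with
    | pure m n => simp
    | hadd x y hx hy => rw [map_add, hx, hy]
  mul_smul s t x := by
    change map _ _ x = map _ _ (map _ _ x)
    induction x using induction_on with
    | pure m n => simp [mul_smul]
    | hadd x y hx hy => simp only [map_add, hx, hy]
  smul_zero t := map_zero (map _ _)
  smul_add t x y := map_add (map _ _) x y
  add_smul s t x := by
    change map _ _ x = map _ _ x + map _ _ x
    induction x using induction_on with
    | pure m n => simp [add_smul, tmul_add]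
    | hadd x y hx hy =>
      simp only [map_add] at hx hy ⊢
      rw [hx, hy]
      abel
  zero_smul x := by
    change map _ _ x = 0
    induction x using induction_on with
    | pure m n =>
      have h := tmul_add A m (0 : N) 0
      rw [add_zero] at h
      simpa using h
    | hadd x y hx hy => simp only [map_add, hx, hy, add_zero]

/-- Degree `k` part of `M ⊗_A N`: generated by the `m ⊗ n` with `m ∈ Mᵢ`, `n ∈ Nⱼ`,
`i + j = k`. -/
def tensorGrading (𝓜 : ZMod 2 → AddSubgroup M) (𝓝 : ZMod 2 → AddSubgroup N) (k : ZMod 2) :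
    AddSubgroup (BalTensor A M N) :=
  AddSubgroup.closure {x | ∃ (i j : ZMod 2) (m : M) (n : N),
    i + j = k ∧ m ∈ 𝓜 i ∧ n ∈ 𝓝 j ∧ x = tmul A m n}

theorem tmul_mem_tensorGrading {𝓜 : ZMod 2 → AddSubgroup M} {𝓝 : ZMod 2 → AddSubgroup N}
    {i j : ZMod 2} {m : M} {n : N} (hm : m ∈ 𝓜 i) (hn : n ∈ 𝓝 j) :
    tmul A m n ∈ tensorGrading (A := A) 𝓜 𝓝 (i + j) :=
  AddSubgroup.subset_closure ⟨i, j, m, n, rfl, hm, hn, rfl⟩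

theorem map_mem_tensorGrading {𝓜 : ZMod 2 → AddSubgroup M} {𝓝 : ZMod 2 → AddSubgroup N}
    {G : Type*} [AddCommGroup G] {𝓖 : AddSubgroup G} {k : ZMod 2} (f : BalTensor A M N →+ G)
    (h : ∀ i j m n, i + j = k → m ∈ 𝓜 i → n ∈ 𝓝 j → f (tmul A m n) ∈ 𝓖)
    {x : BalTensor A M N} (hx : x ∈ tensorGrading 𝓜 𝓝 k) : f x ∈ 𝓖 := by
  have : tensorGrading 𝓜 𝓝 k ≤ 𝓖.comap f := by
    refine (AddSubgroup.closure_le _).2 ?_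
    rintro _ ⟨i, j, m, n, hk, hm, hn, rfl⟩
    exact h i j m n hk hm hn
  exact this hx

/-- Degree `k` component of `m ⊗ n`. -/
def tensorProjAux {𝓜 : ZMod 2 → AddSubgroup M} {𝓝 : ZMod 2 → AddSubgroup N}
    (hM : DirectSum.IsInternal 𝓜) (hN : DirectSum.IsInternal 𝓝) (k : ZMod 2) :
    M →+ N →+ BalTensor A M N :=
  ∑ i, ((tmulHom A).compl₂ (gradeProj hN (k - i))).comp (gradeProj hM i)

theorem tensorProjAux_apply {𝓜 : ZMod 2 → AddSubgroup M} {𝓝 : ZMod 2 → AddSubgroup N}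
    (hM : DirectSum.IsInternal 𝓜) (hN : DirectSum.IsInternal 𝓝) (k : ZMod 2)
    {i j : ZMod 2} {m : M} {n : N} (hm : m ∈ 𝓜 i) (hn : n ∈ 𝓝 j) :
    tensorProjAux (A := A) hM hN k m n = if i + j = k then tmul A m n else 0 := by
  rw [tensorProjAux, AddMonoidHom.finsetSum_apply, AddMonoidHom.finsetSum_apply,
    Finset.sum_eq_single i]
  · change tmulHom A (gradeProj hM i m) (gradeProj hN (k - i) n) = _
    rw [gradeProj_same hM hm]
    split_ifs with h
    · rw [gradeProj_same hN (k := k - i) (by rwa [← h, add_sub_cancel_left])]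
      rfl
    · rw [gradeProj_ne hN hn (fun e => h (by rw [e, add_sub_cancel])), map_zero]
  · intro l _ hl
    change tmulHom A (gradeProj hM l m) (gradeProj hN (k - l) n) = _
    rw [gradeProj_ne hM hm hl.symm, map_zero, AddMonoidHom.zero_apply]
  · simp

theorem tensorGrading_isInternal {𝒜 : ZMod 2 → AddSubgroup A} {𝓜 : ZMod 2 → AddSubgroup M}
    {𝓝 : ZMod 2 → AddSubgroup N} (hA : DirectSum.IsInternal 𝒜)
    (hM : DirectSum.IsInternal 𝓜) (hN : DirectSum.IsInternal 𝓝)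
    (sM : ∀ {i j : ZMod 2} {a : A} {m : M}, a ∈ 𝒜 i → m ∈ 𝓜 j → op a • m ∈ 𝓜 (i + j))
    (sN : ∀ {i j : ZMod 2} {a : A} {n : N}, a ∈ 𝒜 i → n ∈ 𝓝 j → a • n ∈ 𝓝 (i + j)) :
    DirectSum.IsInternal (tensorGrading (A := A) 𝓜 𝓝) := by
  have bal : ∀ (k : ZMod 2) (m : M) (a : A) (n : N),
      tensorProjAux (A := A) hM hN k (op a • m) n = tensorProjAux hM hN k m (a • n) := by
    intro k m a n
    induction a using grade_induction hA with
    | hadd x y hx hy => simp only [MulOpposite.op_add, add_smul, map_add, AddMonoidHom.add_apply, hx, hy]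
    | hom j a ha =>
      induction m using grade_induction hM with
      | hadd x y hx hy => simp only [smul_add, map_add, AddMonoidHom.add_apply, hx, hy]
      | hom i m hm =>
        induction n using grade_induction hN with
        | hadd x y hx hy => simp only [smul_add, map_add, hx, hy]
        | hom l n hn =>
          rw [tensorProjAux_apply hM hN k (sM ha hm) hn,
            tensorProjAux_apply hM hN k hm (sN ha hn), smul_tmul, add_comm j i, add_assoc]
  have gen : ∀ (k : ZMod 2) {i j : ZMod 2} {m : M} {n : N}, m ∈ 𝓜 i → n ∈ 𝓝 j →
      lift (tensorProjAux hM hN k) (bal k) (tmul A m n) = if i + j = k then tmul A m n else 0 :=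
    fun k _ _ _ _ hm hn => tensorProjAux_apply hM hN k hm hn
  have hind : ∀ {C : BalTensor A M N → Prop} (x : BalTensor A M N),
      (∀ i j m n, m ∈ 𝓜 i → n ∈ 𝓝 j → C (tmul A m n)) →
      (∀ x y, C x → C y → C (x + y)) → C x := by
    intro C x pure hadd
    induction x using induction_on with
    | hadd x y hx hy => exact hadd x y hx hy
    | pure m n =>
      induction m using grade_induction hM with
      | hadd x y hx hy => rw [add_tmul]; exact hadd _ _ hx hy
      | hom i m hm =>
        induction n using grade_induction hN with
        | hadd x y hx hy => rw [tmul_add]; exact hadd _ _ hx hy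
        | hom j n hn => exact pure i j m n hm hn
  refine isInternal_of_proj (fun k => lift (tensorProjAux hM hN k) (bal k)) ?_ ?_ ?_ ?_
  · intro k x
    refine hind (C := fun x => lift (tensorProjAux hM hN k) (bal k) x ∈ tensorGrading 𝓜 𝓝 k) x
      (fun i j m n hm hn => ?_) (fun x y hx hy => ?_)
    · rw [gen k hm hn]
      split_ifs with h
      · exact h ▸ tmul_mem_tensorGrading hm hn
      · exact zero_mem _
    · rw [map_add]
      exact add_mem hx hy
  · intro k x hx
    have h0 := map_mem_tensorGrading (𝓖 := ⊥)
      (lift (tensorProjAux hM hN k) (bal k) - AddMonoidHom.id _) (fun i j m n hk hm hn => by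
        rw [AddMonoidHom.sub_apply, gen k hm hn, if_pos hk]
        simp) hx
    exact sub_eq_zero.1 h0
  · intro l k x hlk hx
    exact map_mem_tensorGrading (𝓖 := ⊥) (lift (tensorProjAux hM hN k) (bal k))
      (fun i j m n hk hm hn => by
        rw [gen k hm hn, if_neg (fun e => hlk (hk.symm.trans e))]
        simp) hx
  · intro x
    refine hind (C := fun x => ∑ k, lift (tensorProjAux hM hN k) (bal k) x = x) x
      (fun i j m n hm hn => ?_) (fun x y hx hy => ?_)
    · simp [gen _ hm hn]
    · simp only [map_add, Finset.sum_add_distrib, hx, hy]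

end BalTensor

end BalTensor

/-! ### Super bimodules and the functors they define -/

/-- An `(S, R)`-super bimodule. -/
structure SuperBimod {S R : Type u} [Ring S] [Ring R] (𝓢 : ZMod 2 → AddSubgroup S)
    (𝓡 : ZMod 2 → AddSubgroup R) where
  carrier : Type u
  [addCommGroup : AddCommGroup carrier]
  [moduleLeft : Module S carrier]
  [moduleRight : Module Rᵐᵒᵖ carrier]
  [smulComm : SMulCommClass S Rᵐᵒᵖ carrier]
  grading : ZMod 2 → AddSubgroup carrier
  isInternal : DirectSum.IsInternal grading
  smul_mem_left : ∀ {i j : ZMod 2} {s : S} {b : carrier}, s ∈ 𝓢 i → b ∈ grading j →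
    s • b ∈ grading (i + j)
  smul_mem_right : ∀ {i j : ZMod 2} {r : R} {b : carrier}, r ∈ 𝓡 i → b ∈ grading j →
    op r • b ∈ grading (i + j)

namespace SuperBimod

variable {S R : Type u} [Ring S] [Ring R] {𝓢 : ZMod 2 → AddSubgroup S}
  {𝓡 : ZMod 2 → AddSubgroup R}

instance : CoeSort (SuperBimod 𝓢 𝓡) (Type u) := ⟨SuperBimod.carrier⟩

attribute [instance] SuperBimod.addCommGroup SuperBimod.moduleLeft SuperBimod.moduleRight
  SuperBimod.smulComm

instance (B : SuperBimod 𝓢 𝓡) : SMulCommClass Rᵐᵒᵖ S B := SMulCommClass.symm _ _ _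

/-- The right `R`-supermodule `M ⊗_S B`, with `(m ⊗ b) r = m ⊗ (b r)`. -/
def tensorRightObj [GradedRing 𝓢] (B : SuperBimod 𝓢 𝓡) (M : RightSuperMod 𝓢) :
    RightSuperMod 𝓡 where
  carrier := BalTensor S M B
  module := BalTensor.moduleRight Rᵐᵒᵖ
  grading := BalTensor.tensorGrading M.grading B.grading
  isInternal := BalTensor.tensorGrading_isInternal (DirectSum.Decomposition.isInternal 𝓢)
    M.isInternal B.isInternal (fun ha hm => M.smul_mem (mem_opGrading.2 ha) hm) B.smul_mem_left
  smul_mem {i j r x} hr hx := by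
    refine BalTensor.map_mem_tensorGrading (BalTensor.map LinearMap.id
      (Module.toModuleEnd S (S := Rᵐᵒᵖ) B r)) ?_ hx
    rintro k l m b rfl hm hb
    have h := BalTensor.tmul_mem_tensorGrading (A := S) hm (B.smul_mem_right hr hb)
    rwa [← add_assoc, add_comm k i, add_assoc] at h

/-- The functor `- ⊗_S B` from right `S`-supermodules to right `R`-supermodules. -/
def tensorRight [GradedRing 𝓢] (B : SuperBimod 𝓢 𝓡) : RightSuperMod 𝓢 ⥤ RightSuperMod 𝓡 where
  obj M := tensorRightObj B M
  map {M N} f :=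
    { toLin :=
        { toFun := BalTensor.map f.toLin (LinearMap.id (M := B))
          map_add' := map_add _
          map_smul' := fun r x => by
            change BalTensor.map _ _ (BalTensor.map _ _ x) =
              BalTensor.map _ _ (BalTensor.map _ _ x)
            induction x using BalTensor.induction_on with
            | pure m b => rfl
            | hadd x y hx hy => simp only [map_add, hx, hy] }
      map_mem := fun k x hx => by
        refine BalTensor.map_mem_tensorGrading (BalTensor.map f.toLin (LinearMap.id (M := B)))
          ?_ hx
        rintro i j m b rfl hm hb
        exact BalTensor.tmul_mem_tensorGrading (f.map_mem i m hm) hb }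
  map_id M := SuperMod.Hom.ext (LinearMap.ext fun x => by
    change BalTensor.map _ _ x = x
    induction x using BalTensor.induction_on with
    | pure m b => rfl
    | hadd x y hx hy => rw [map_add, hx, hy])
  map_comp f g := SuperMod.Hom.ext (LinearMap.ext fun x => by
    change BalTensor.map _ _ x = BalTensor.map _ _ (BalTensor.map _ _ x)
    induction x using BalTensor.induction_on with
    | pure m b => rfl
    | hadd x y hx hy => simp only [map_add, hx, hy])

/-- The left `S`-supermodule `B ⊗_R M`, with `s (b ⊗ m) = (s b) ⊗ m`. -/
def tensorLeftObj [GradedRing 𝓡] (B : SuperBimod 𝓢 𝓡) (M : LeftSuperMod 𝓡) :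
    LeftSuperMod 𝓢 where
  carrier := BalTensor R B M
  module := BalTensor.moduleLeft S
  grading := BalTensor.tensorGrading B.grading M.grading
  isInternal := BalTensor.tensorGrading_isInternal (DirectSum.Decomposition.isInternal 𝓡)
    B.isInternal M.isInternal B.smul_mem_right M.smul_mem
  smul_mem {i j s x} hs hx := by
    refine BalTensor.map_mem_tensorGrading (BalTensor.map
      (Module.toModuleEnd Rᵐᵒᵖ (S := S) B s) LinearMap.id) ?_ hx
    rintro k l b m rfl hb hm
    have h := BalTensor.tmul_mem_tensorGrading (A := R) (B.smul_mem_left hs hb) hm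
    rwa [add_assoc] at h

/-- The functor `B ⊗_R -` from left `R`-supermodules to left `S`-supermodules. -/
def tensorLeft [GradedRing 𝓡] (B : SuperBimod 𝓢 𝓡) : LeftSuperMod 𝓡 ⥤ LeftSuperMod 𝓢 where
  obj M := tensorLeftObj B M
  map {M N} f :=
    { toLin :=
        { toFun := BalTensor.map (LinearMap.id (M := B)) f.toLin
          map_add' := map_add _
          map_smul' := fun r x => by
            change BalTensor.map _ _ (BalTensor.map _ _ x) =
              BalTensor.map _ _ (BalTensor.map _ _ x)
            induction x using BalTensor.induction_on with
            | pure m b => rfl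
            | hadd x y hx hy => simp only [map_add, hx, hy] }
      map_mem := fun k x hx => by
        refine BalTensor.map_mem_tensorGrading (BalTensor.map (LinearMap.id (M := B)) f.toLin)
          ?_ hx
        rintro i j b m rfl hb hm
        exact BalTensor.tmul_mem_tensorGrading hb (f.map_mem j m hm) }
  map_id M := SuperMod.Hom.ext (LinearMap.ext fun x => by
    change BalTensor.map _ _ x = x
    induction x using BalTensor.induction_on with
    | pure m b => rfl
    | hadd x y hx hy => rw [map_add, hx, hy])
  map_comp f g := SuperMod.Hom.ext (LinearMap.ext fun x => by
    change BalTensor.map _ _ x = BalTensor.map _ _ (BalTensor.map _ _ x)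
    induction x using BalTensor.induction_on with
    | pure m b => rfl
    | hadd x y hx hy => simp only [map_add, hx, hy])

end SuperBimod

/-! ### The super Morita context of a right supermodule -/

namespace RightSuperMod

variable {R : Type u} [Ring R] {𝓡 : ZMod 2 → AddSubgroup R} (P : RightSuperMod 𝓡)

/-- The ring `S = End(P_R)` of all `R`-linear endomorphisms, acting on `P` on the left. -/
abbrev EndRing : Type u := Module.End Rᵐᵒᵖ P

/-- `S₀` consists of the parity-preserving endomorphisms, `S₁` of the parity-reversing ones. -/
abbrev endGrading : ZMod 2 → AddSubgroup (EndRing P) := homGrading P.grading P.grading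

instance [GradedRing 𝓡] : GradedRing (endGrading P) :=
  { (homGrading_isInternal (𝒜 := opGrading 𝓡)
      (opGrading_isInternal (DirectSum.Decomposition.isInternal 𝓡)) P.isInternal P.isInternal
      P.smul_mem P.smul_mem).chooseDecomposition with
    one_mem := fun i m hm => by simpa using hm
    mul_mem := fun i j f g hf hg l m hm => by
      have h := hf _ _ (hg l m hm)
      rwa [add_assoc, add_comm j i] at h }

/-- `P` as an `(S, R)`-bimodule. -/
abbrev selfBimod : SuperBimod (endGrading P) 𝓡 where
  carrier := P
  grading := P.grading
  isInternal := P.isInternal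
  smul_mem_left {i j s p} hs hp := by
    have h := hs j p hp
    rwa [add_comm] at h
  smul_mem_right hr hp := P.smul_mem (mem_opGrading.2 hr) hp

/-- The underlying group of the dual `Q = P*`: all `R`-linear maps `P → R`. -/
abbrev Dual : Type u := P →ₗ[Rᵐᵒᵖ] R

/-- The right action of `S` on `Q`: `(q s)(p) = q (s p)`. -/
instance dualModuleRight : Module (EndRing P)ᵐᵒᵖ (Dual P) where
  smul s q := q ∘ₗ (unop s : P →ₗ[Rᵐᵒᵖ] P)
  one_smul _ := rfl
  mul_smul _ _ _ := rfl
  smul_zero _ := rfl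
  smul_add _ _ _ := rfl
  add_smul s t q := LinearMap.ext fun p => map_add q (unop s p) (unop t p)
  zero_smul q := LinearMap.ext fun _ => map_zero q

/-- The dual `Q = P*` as an `(R, S)`-bimodule, with `(r q)(p) = r (q p)` and
`(q s)(p) = q (s p)`. -/
abbrev dualBimod [GradedRing 𝓡] : SuperBimod 𝓡 (endGrading P) where
  carrier := Dual P
  smulComm := ⟨fun _ _ _ => rfl⟩
  grading := homGrading P.grading 𝓡
  isInternal := homGrading_isInternal (𝒜 := opGrading 𝓡)
    (opGrading_isInternal (DirectSum.Decomposition.isInternal 𝓡)) P.isInternal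
    (DirectSum.Decomposition.isInternal 𝓡) P.smul_mem (fun {i j a r} ha hr => by
      have h := SetLike.mul_mem_graded hr (mem_opGrading.1 ha)
      rwa [add_comm] at h)
  smul_mem_left {i j r q} hr hq l p hp := by
    have h := SetLike.mul_mem_graded hr (hq l p hp)
    rwa [add_left_comm] at h
  smul_mem_right {i j s q} hs hq l p hp := by
    have h := hq _ _ (hs l p hp)
    rwa [add_assoc] at h

@[simp]
theorem dual_smul_left_apply (r : R) (q : Dual P) (p : P) : (r • q) p = r * q p := rfl

@[simp]
theorem dual_smul_right_apply (s : EndRing P) (q : Dual P) (p : P) :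
    (op s • q) p = q (s p) := rfl

end RightSuperMod

/-- `F` and `G` are mutually inverse equivalences of categories. -/
def MutuallyInverseEquivalences {C D : Type*} [Category C] [Category D] (F : C ⥤ D)
    (G : D ⥤ C) : Prop :=
  F.IsEquivalence ∧ G.IsEquivalence ∧ Nonempty (F ⋙ G ≅ 𝟭 C) ∧ Nonempty (G ⋙ F ≅ 𝟭 D)

end

/-! ### Gradings on kernels and quotients -/

section Grading

variable {M N : Type*} [AddCommGroup M] [AddCommGroup N] {𝓜 : ZMod 2 → AddSubgroup M}
  {𝓝 : ZMod 2 → AddSubgroup N}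

/-! The argument is the classical Morita context, carried out with homogeneous data. Between `P` and
`Q` there are two pairings, `φ(p, q) = (x ↦ p q(x))` with values in `S` and `ψ(q, p) = q(p)` with
values in `R`. Both are additive, balanced, bilinear over the outer rings and degree-additive, and
they satisfy `φ(p, q) p' = p ψ(q, p')` and `ψ(q, p) q' = q φ(p, q')`. No signs occur, because right
modules are modules over the plain opposite ring.

If the values of `φ` additively generate `1`, the evaluations `(n ⊗ p) ⊗ q ↦ n φ(p, q)` and `p ⊗ (q
⊗ n) ↦ φ(p, q) n` are natural isomorphisms onto `n`'s module: they are clearly onto, and the two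
associativity laws produce a left inverse (`evalRight_injective`, `evalLeft_injective`). Exchanging
the roles of `P` and `Q` settles the other two composites.

What is left is that each pairing generates `1`, and here the hypotheses on `P` enter. For `φ` this
is the dual basis property of a finitely generated projective (`one_mem_closure_rankOne`). For `ψ`
it says that the trace ideal of a generator is all of `R`
(`IsGenerator.one_mem_closure_evalPairing`). Projectivity and generation are tested only on
supermodules and parity-preserving morphisms, so the kernel, the free module and the quotient used
as tests all have to be graded. -/

theorem map_gradeProj (hM : DirectSum.IsInternal 𝓜) (hN : DirectSum.IsInternal 𝓝) (f : M →+ N)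
    (hf : ∀ i m, m ∈ 𝓜 i → f m ∈ 𝓝 i) (k : ZMod 2) (x : M) :
    f (gradeProj hM k x) = gradeProj hN k (f x) := by
  induction x using grade_induction hM with
  | hom i x hx =>
    by_cases h : i = k
    · subst h
      rw [gradeProj_same hM hx, gradeProj_same hN (hf i x hx)]
    · rw [gradeProj_ne hM hx h, gradeProj_ne hN (hf i x hx) h, map_zero]
  | hadd x y hx hy => simp only [map_add, hx, hy]

/-- The preimage of a grading under an injection with graded image is a grading. -/
theorem isInternal_comap (hN : DirectSum.IsInternal 𝓝) (f : M →+ N) (hf : Function.Injective f)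
    (hr : ∀ k x, ∃ y, f y = gradeProj hN k (f x)) :
    DirectSum.IsInternal fun k => (𝓝 k).comap f := by
  choose g hg using hr
  refine isInternal_of_proj (fun k => AddMonoidHom.mk' (g k) fun x y => hf ?_) ?_ ?_ ?_ ?_
  · simp only [map_add, hg]
  · intro k x
    change f (g k x) ∈ 𝓝 k
    rw [hg]
    exact gradeProj_mem hN k _
  · intro k x hx
    refine hf ?_
    change f (g k x) = f x
    rw [hg, gradeProj_same hN hx]
  · intro j k x hjk hx
    refine hf ?_
    change f (g k x) = f 0
    rw [hg, gradeProj_ne hN hx hjk, map_zero]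
  · intro x
    refine hf ?_
    rw [map_sum]
    change ∑ k, f (g k x) = f x
    simp only [hg, sum_gradeProj]

/-- The image of a grading under a surjection with graded kernel is a grading. -/
theorem isInternal_map (hM : DirectSum.IsInternal 𝓜) (f : M →+ N) (hf : Function.Surjective f)
    (hk : ∀ k x, f x = 0 → f (gradeProj hM k x) = 0) :
    DirectSum.IsInternal fun k => (𝓜 k).map f := by
  choose g hg using hf
  -- The chosen preimages `g` need not be additive. The image of a homogeneous component does not
  -- depend on the preimage, since two preimages differ by an element of the graded kernel.
  have key : ∀ k x, f (gradeProj hM k (g (f x))) = f (gradeProj hM k x) := by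
    intro k x
    have h := hk k (g (f x) - x) (by rw [map_sub, hg, sub_self])
    rw [map_sub, map_sub] at h
    exact sub_eq_zero.1 h
  refine isInternal_of_proj (fun k => AddMonoidHom.mk' (fun y => f (gradeProj hM k (g y)))
    fun x y => ?_) ?_ ?_ ?_ ?_
  · rw [← map_add, ← map_add, ← key k (g x + g y), map_add f, hg, hg]
  · intro k x
    exact ⟨_, gradeProj_mem hM k _, rfl⟩
  · rintro k _ ⟨x, hx, rfl⟩
    refine (key k x).trans ?_
    rw [gradeProj_same hM hx]
  · rintro j k _ hjk ⟨x, hx, rfl⟩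
    refine (key k x).trans ?_
    rw [gradeProj_ne hM hx hjk, map_zero]
  · intro x
    change ∑ k, f (gradeProj hM k (g x)) = x
    rw [← map_sum, sum_gradeProj, hg]

end Grading

/-! ### Isomorphisms, kernels and quotients of supermodules -/

namespace SuperMod

variable {A : Type u} [Ring A] {𝒜 : ZMod 2 → AddSubgroup A}

/-- A bijective morphism of supermodules is an isomorphism. -/
noncomputable def isoOfBijective {M N : SuperMod 𝒜} (f : M ⟶ N) (hf : Function.Bijective f.toLin) : M ≅ N where
  hom := f
  inv :=
    { toLin := (LinearEquiv.ofBijective f.toLin hf).symm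
      map_mem := fun i n hn => by
        obtain ⟨m, rfl⟩ := hf.2 n
        -- Since `f` commutes with the projections, `m` and its degree `i` component have the same
        -- image, so injectivity makes `m` homogeneous.
        have h := map_gradeProj M.isInternal N.isInternal f.toLin.toAddMonoidHom f.map_mem i m
        change f.toLin _ = gradeProj _ i (f.toLin m) at h
        rw [gradeProj_same N.isInternal hn] at h
        have e : (LinearEquiv.ofBijective f.toLin hf).symm (f.toLin m) = m :=
          (LinearEquiv.ofBijective f.toLin hf).symm_apply_apply m
        change (LinearEquiv.ofBijective f.toLin hf).symm (f.toLin m) ∈ M.grading i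
        rw [e, ← hf.1 h]
        exact gradeProj_mem M.isInternal i m }
  hom_inv_id := Hom.ext (LinearMap.ext fun m =>
    (LinearEquiv.ofBijective f.toLin hf).symm_apply_apply m)
  inv_hom_id := Hom.ext (LinearMap.ext fun n =>
    (LinearEquiv.ofBijective f.toLin hf).apply_symm_apply n)

/-- The kernel of a morphism of supermodules. -/
def ker {M N : SuperMod 𝒜} (f : M ⟶ N) : SuperMod 𝒜 where
  carrier := LinearMap.ker f.toLin
  grading k := (M.grading k).comap (LinearMap.ker f.toLin).subtype.toAddMonoidHom
  isInternal := isInternal_comap M.isInternal _ Subtype.val_injective (fun k x =>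
    ⟨⟨gradeProj M.isInternal k x.1, by
      have h := map_gradeProj M.isInternal N.isInternal f.toLin.toAddMonoidHom f.map_mem k x.1
      change f.toLin _ = gradeProj _ k (f.toLin x.1) at h
      rw [LinearMap.mem_ker, h, LinearMap.mem_ker.1 x.2, map_zero]⟩, rfl⟩)
  smul_mem ha hm := M.smul_mem ha hm

/-- The inclusion of the kernel. -/
def kerι {M N : SuperMod 𝒜} (f : M ⟶ N) : ker f ⟶ M :=
  ⟨(LinearMap.ker f.toLin).subtype, fun _ _ h => h⟩

/-- The identity of `P` lifts through `f`. Projectivity is phrased with short exact sequences, so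
the kernel of `f` is needed as a supermodule to complete the sequence. The section obtained is even,
but only its linearity is used later. -/
theorem IsProjective.exists_section {P : SuperMod 𝒜} (hP : P.IsProjective) {M : SuperMod 𝒜}
    (f : M ⟶ P) (hf : Function.Surjective f.toLin) :
    ∃ h : P →ₗ[A] M, ∀ x, f.toLin (h x) = x := by
  obtain ⟨h, hh⟩ := (hP (ker f) M P (kerι f) f Subtype.val_injective
    (LinearMap.exact_subtype_ker_map f.toLin) hf).2.2 (𝟙 P)
  exact ⟨h.toLin, fun x => LinearMap.congr_fun (congrArg Hom.toLin hh) x⟩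

/-- The quotient of a supermodule by a graded submodule. -/
def quotient (M : SuperMod 𝒜) (T : Submodule A M)
    (hT : ∀ k, ∀ x ∈ T, gradeProj M.isInternal k x ∈ T) : SuperMod 𝒜 where
  carrier := M ⧸ T
  grading k := (M.grading k).map T.mkQ.toAddMonoidHom
  isInternal := isInternal_map M.isInternal _ T.mkQ_surjective (fun k x hx =>
    (Submodule.Quotient.mk_eq_zero T).2 (hT k x ((Submodule.Quotient.mk_eq_zero T).1 hx)))
  smul_mem := by
    rintro i j a _ ha ⟨m, hm, rfl⟩
    exact ⟨a • m, M.smul_mem ha hm, rfl⟩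

/-- The quotient map. -/
def quotientMk (M : SuperMod 𝒜) (T : Submodule A M)
    (hT : ∀ k, ∀ x ∈ T, gradeProj M.isInternal k x ∈ T) : M ⟶ M.quotient T hT :=
  ⟨T.mkQ, fun _ m h => ⟨m, h, rfl⟩⟩

end SuperMod

/-! ### Super Morita contexts -/

/-- Bimodules `B` and `C` with pairings `B × C → S` and `C × B → R` whose values
generate `S` and `R`. -/
structure SuperMorita {S R : Type u} [Ring S] [Ring R] {𝓢 : ZMod 2 → AddSubgroup S}
    {𝓡 : ZMod 2 → AddSubgroup R} (B : SuperBimod 𝓢 𝓡) (C : SuperBimod 𝓡 𝓢) where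
  φ : B →+ C →+ S
  ψ : C →+ B →+ R
  φ_smul : ∀ (s : S) b c, φ (s • b) c = s * φ b c
  φ_op_smul : ∀ (s : S) b c, φ b (op s • c) = φ b c * s
  φ_bal : ∀ (r : R) b c, φ (op r • b) c = φ b (r • c)
  φ_mem : ∀ {i j b c}, b ∈ B.grading i → c ∈ C.grading j → φ b c ∈ 𝓢 (i + j)
  ψ_smul : ∀ (r : R) c b, ψ (r • c) b = r * ψ c b
  ψ_op_smul : ∀ (r : R) c b, ψ c (op r • b) = ψ c b * r
  ψ_bal : ∀ (s : S) c b, ψ (op s • c) b = ψ c (s • b)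
  ψ_mem : ∀ {i j c b}, c ∈ C.grading i → b ∈ B.grading j → ψ c b ∈ 𝓡 (i + j)
  φψ : ∀ b c b', φ b c • b' = op (ψ c b') • b
  ψφ : ∀ c b c', ψ c b • c' = op (φ b c') • c
  -- The subgroup generated by the values is a two-sided ideal by `φ_smul` and `φ_op_smul`, so
  -- containing `1` makes it everything.
  φ_one : (1 : S) ∈ AddSubgroup.closure {x | ∃ b c, φ b c = x}
  ψ_one : (1 : R) ∈ AddSubgroup.closure {x | ∃ c b, ψ c b = x}

namespace SuperMorita

variable {S R : Type u} [Ring S] [Ring R] {𝓢 : ZMod 2 → AddSubgroup S}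
  {𝓡 : ZMod 2 → AddSubgroup R} {B : SuperBimod 𝓢 𝓡} {C : SuperBimod 𝓡 𝓢}

/-- Exchange the two bimodules. -/
def symm (c : SuperMorita B C) : SuperMorita C B :=
  ⟨c.ψ, c.φ, c.ψ_smul, c.ψ_op_smul, c.ψ_bal, c.ψ_mem, c.φ_smul, c.φ_op_smul, c.φ_bal, c.φ_mem,
    c.ψφ, c.φψ, c.ψ_one, c.φ_one⟩

variable [GradedRing 𝓢] [GradedRing 𝓡] (κ : SuperMorita B C)

/-! ### Right supermodules: comparing `(N ⊗ B) ⊗ C` with `N` -/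

section Right

variable (N : RightSuperMod 𝓢)

/-- The pure tensor `(n ⊗ b) ⊗ c`. -/
def tripleRight (n : N) (b : B) (c : C) : C.tensorRightObj (B.tensorRightObj N) :=
  BalTensor.tmul (M := B.tensorRightObj N) (N := C) R (BalTensor.tmul S n b) c

variable {N} in
theorem tripleRight_induction {p : C.tensorRightObj (B.tensorRightObj N) → Prop}
    (x : C.tensorRightObj (B.tensorRightObj N)) (pure : ∀ n b c, p (tripleRight N n b c))
    (hadd : ∀ x y, p x → p y → p (x + y)) : p x := by
  refine BalTensor.induction_on (M := B.tensorRightObj N) (N := C) x (fun y c => ?_) hadd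
  refine BalTensor.induction_on (M := N) (N := B)
    (C := fun y => p (BalTensor.tmul (M := B.tensorRightObj N) R y c)) y
    (fun n b => pure n b c) (fun y z hy hz => ?_)
  have h := hadd _ _ hy hz
  exact (BalTensor.add_tmul (M := B.tensorRightObj N) R y z c) ▸ h

/-- The biadditive map `(n ⊗ b, c) ↦ n φ(b, c)`. -/
def pairRight : B.tensorRightObj N →+ C →+ N :=
  BalTensor.lift (M := N) (N := B)
    (AddMonoidHom.mk' (fun n => AddMonoidHom.mk' (fun b => AddMonoidHom.mk'
        (fun c => op (κ.φ b c) • n)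
        (fun c c' => by rw [map_add, MulOpposite.op_add, add_smul]))
      (fun b b' => by ext c; simp [add_smul]))
      (fun n n' => by ext b c; simp))
    (fun n s b => by ext c; simp [κ.φ_smul, mul_smul])

omit [GradedRing 𝓡] in
theorem pairRight_smul (y : B.tensorRightObj N) (r : R) (c : C) :
    κ.pairRight N (op r • y) c = κ.pairRight N y (r • c) := by
  have h : ((κ.pairRight N).flip c).comp
      (DistribSMul.toAddMonoidHom (B.tensorRightObj N) (op r)) =
      (κ.pairRight N).flip (r • c) :=
    BalTensor.addHom_ext (M := N) (N := B) fun n b => by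
      change op (κ.φ (op r • b) c) • n = op (κ.φ b (r • c)) • n
      rw [κ.φ_bal]
  exact DFunLike.congr_fun h y

/-- The map `(n ⊗ b) ⊗ c ↦ n φ(b, c)`. -/
def evalRight : C.tensorRightObj (B.tensorRightObj N) →+ N :=
  BalTensor.lift (M := B.tensorRightObj N) (N := C) (κ.pairRight N) (κ.pairRight_smul N)

theorem evalRight_triple (n : N) (b : B) (c : C) :
    κ.evalRight N (tripleRight N n b c) = op (κ.φ b c) • n := rfl

/-- A left inverse is built by writing `1` as a sum of values of `φ`. To avoid choosing such a sum,
the statement is generalised from `1` to every `s` in the subgroup generated by these values, where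
induction applies. -/
theorem evalRight_injective : Function.Injective (κ.evalRight N) := by
  have key : ∀ s ∈ AddSubgroup.closure {x | ∃ b c, κ.φ b c = x},
      ∃ g : N →+ C.tensorRightObj (B.tensorRightObj N), ∀ n b c,
        tripleRight N n b (op s • c) = g (op (κ.φ b c) • n) := by
    intro s hs
    have cadd : ∀ n b c c', tripleRight (B := B) (C := C) N n b (c + c') =
        tripleRight N n b c + tripleRight N n b c' := fun n b c c' =>
      BalTensor.tmul_add (M := B.tensorRightObj N) (N := C) R _ c c'
    let t (n : N) (b : B) : C →+ C.tensorRightObj (B.tensorRightObj N) :=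
      AddMonoidHom.mk' (tripleRight N n b) (cadd n b)
    induction hs using AddSubgroup.closure_induction with
    | mem s hs =>
      obtain ⟨b', c', rfl⟩ := hs
      -- For `s = φ(b', c')` take `g n = (n ⊗ b') ⊗ c'`. Then `(n ⊗ b) ⊗ c φ(b', c') = (n ⊗ b) ⊗
      -- ψ(c, b') c' = (n ⊗ b ψ(c, b')) ⊗ c' = (n ⊗ φ(b, c) b') ⊗ c' = (n φ(b, c) ⊗ b') ⊗ c'`.
      refine ⟨AddMonoidHom.mk' (fun n => tripleRight N n b' c') (fun n n' => ?_),
        fun n b c => ?_⟩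
      · refine Eq.trans ?_ (BalTensor.add_tmul (M := B.tensorRightObj N) (N := C) R _ _ c')
        exact congrArg (fun y => BalTensor.tmul (M := B.tensorRightObj N) (N := C) R y c')
          (BalTensor.add_tmul S n n' b')
      · rw [← κ.ψφ]
        refine (BalTensor.smul_tmul (M := B.tensorRightObj N) (N := C) R _ (κ.ψ c b') c').symm.trans
          ?_
        refine congrArg (fun y => BalTensor.tmul (M := B.tensorRightObj N) (N := C) R y c') ?_
        change BalTensor.tmul S n (op (κ.ψ c b') • b) = BalTensor.tmul S (op (κ.φ b c) • n) b'
        rw [← κ.φψ, BalTensor.smul_tmul]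
    | zero => exact ⟨0, fun n b c => by rw [op_zero, zero_smul]; exact map_zero (t n b)⟩
    | add s s' _ _ hs hs' =>
      obtain ⟨g, hg⟩ := hs
      obtain ⟨g', hg'⟩ := hs'
      exact ⟨g + g', fun n b c => by
        rw [MulOpposite.op_add, add_smul, cadd, hg, hg', AddMonoidHom.add_apply]⟩
    | neg s _ hs =>
      obtain ⟨g, hg⟩ := hs
      exact ⟨-g, fun n b c => by
        rw [MulOpposite.op_neg, neg_smul, AddMonoidHom.neg_apply, ← hg]
        exact map_neg (t n b) _⟩
  -- At `s = 1` the identity in `key` says that `g` undoes the evaluation on pure triples.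
  obtain ⟨g, hg⟩ := key 1 κ.φ_one
  refine Function.LeftInverse.injective (g := g) fun x => ?_
  induction x using tripleRight_induction with
  | pure n b c => rw [evalRight_triple, ← hg, op_one, one_smul]
  | hadd x y hx hy => rw [map_add, map_add, hx, hy]

/-- The `s` with `n s` in the range form a subgroup that contains every value of `φ`, hence `1`. -/
theorem evalRight_surjective : Function.Surjective (κ.evalRight N) := by
  intro n
  have key : ∀ s ∈ AddSubgroup.closure {x | ∃ b c, κ.φ b c = x},
      op s • n ∈ (κ.evalRight N).range := by
    intro s hs
    induction hs using AddSubgroup.closure_induction with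
    | mem s hs =>
      obtain ⟨b, c, rfl⟩ := hs
      exact ⟨tripleRight N n b c, rfl⟩
    | zero => simp
    | add s s' _ _ hs hs' => rw [MulOpposite.op_add, add_smul]; exact add_mem hs hs'
    | neg s _ hs => rw [MulOpposite.op_neg, neg_smul]; exact neg_mem hs
  simpa using key 1 κ.φ_one

/-- `evalRight` as a morphism of supermodules. -/
def evalRightHom : C.tensorRightObj (B.tensorRightObj N) ⟶ N where
  toLin :=
    { κ.evalRight N with
      map_smul' := fun s x => by
        change κ.evalRight N (s • x) = s • κ.evalRight N x
        induction x using tripleRight_induction with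
        | pure n b c =>
          change op (κ.φ b (op (unop s) • c)) • n = s • op (κ.φ b c) • n
          rw [κ.φ_op_smul, op_mul, mul_smul, op_unop]
        | hadd x y hx hy => rw [smul_add, map_add, map_add, smul_add, hx, hy] }
  map_mem k x hx := by
    refine BalTensor.map_mem_tensorGrading (M := B.tensorRightObj N) (N := C)
      (𝓜 := (B.tensorRightObj N).grading) (κ.evalRight N) ?_ hx
    rintro i j y c rfl hy hc
    -- The left factor `y` is homogeneous but not yet a pure tensor; with `c` fixed, a second
    -- reduction to generators handles it.
    refine BalTensor.map_mem_tensorGrading (M := N) (N := B) (𝓖 := N.grading (i + j))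
      ((κ.evalRight N).comp ((BalTensor.tmulHom (M := B.tensorRightObj N) (N := C) R).flip c))
      ?_ hy
    rintro k l n b rfl hn hb
    change op (κ.φ b c) • n ∈ _
    have h := N.smul_mem (mem_opGrading.2 (κ.φ_mem hb hc : unop (op (κ.φ b c)) ∈ _)) hn
    rwa [add_comm, ← add_assoc] at h

end Right

/-- Tensoring right supermodules with `B` and then with `C` is the identity. -/
noncomputable def tensorRightIso : B.tensorRight ⋙ C.tensorRight ≅ 𝟭 (RightSuperMod 𝓢) :=
  NatIso.ofComponents
    (fun N => SuperMod.isoOfBijective (κ.evalRightHom N)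
      ⟨κ.evalRight_injective N, κ.evalRight_surjective N⟩)
    (fun {M N} f => SuperMod.Hom.ext (LinearMap.ext fun x => by
      change κ.evalRight N (((B.tensorRight ⋙ C.tensorRight).map f).toLin x) =
        f.toLin (κ.evalRight M x)
      refine tripleRight_induction (p := fun x =>
        κ.evalRight N (((B.tensorRight ⋙ C.tensorRight).map f).toLin x) =
          f.toLin (κ.evalRight M x)) x (fun n b c => ?_) (fun x y hx hy => ?_)
      -- On pure triples naturality is the `S`-linearity of `f`.
      · change op (κ.φ b c) • f.toLin n = f.toLin (op (κ.φ b c) • n)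
        rw [map_smul]
      · refine (map_add ((κ.evalRight N).comp
          ((B.tensorRight ⋙ C.tensorRight).map f).toLin.toAddMonoidHom) x y).trans ?_
        rw [map_add, map_add]
        exact congrArg₂ (· + ·) hx hy))

/-! ### Left supermodules: comparing `B ⊗ (C ⊗ N)` with `N` -/

section Left

variable (N : LeftSuperMod 𝓢)

/-- The pure tensor `b ⊗ (c ⊗ n)`. -/
def tripleLeft (b : B) (c : C) (n : N) : B.tensorLeftObj (C.tensorLeftObj N) :=
  BalTensor.tmul (M := B) (N := C.tensorLeftObj N) R b (BalTensor.tmul S c n)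

variable {N} in
theorem tripleLeft_induction {p : B.tensorLeftObj (C.tensorLeftObj N) → Prop}
    (x : B.tensorLeftObj (C.tensorLeftObj N)) (pure : ∀ b c n, p (tripleLeft N b c n))
    (hadd : ∀ x y, p x → p y → p (x + y)) : p x := by
  refine BalTensor.induction_on (M := B) (N := C.tensorLeftObj N) x (fun b y => ?_) hadd
  refine BalTensor.induction_on (M := C) (N := N)
    (C := fun y => p (BalTensor.tmul (N := C.tensorLeftObj N) R b y)) y
    (fun c n => pure b c n) (fun y z hy hz => ?_)
  have h := hadd _ _ hy hz
  exact (BalTensor.tmul_add (N := C.tensorLeftObj N) R b y z) ▸ h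

/-- The biadditive map `(b, c ⊗ n) ↦ φ(b, c) n`. -/
def pairLeft : B →+ C.tensorLeftObj N →+ N :=
  AddMonoidHom.mk' (fun b => BalTensor.lift (M := C) (N := N)
      (AddMonoidHom.mk' (fun c => AddMonoidHom.mk' (fun n => κ.φ b c • n)
          (fun n n' => smul_add _ n n'))
        (fun c c' => by ext n; simp [add_smul]))
      (fun c s n => by simp [κ.φ_op_smul, mul_smul]))
    (fun b b' => BalTensor.addHom_ext fun c n => by
      change κ.φ (b + b') c • n = κ.φ b c • n + κ.φ b' c • n
      rw [map_add, AddMonoidHom.add_apply, add_smul])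

omit [GradedRing 𝓡] in
theorem pairLeft_smul (b : B) (r : R) (y : C.tensorLeftObj N) :
    κ.pairLeft N (op r • b) y = κ.pairLeft N b (r • y) := by
  have h : κ.pairLeft N (op r • b) =
      (κ.pairLeft N b).comp (DistribSMul.toAddMonoidHom (C.tensorLeftObj N) r) :=
    BalTensor.addHom_ext (M := C) (N := N) fun c n => by
      change κ.φ (op r • b) c • n = κ.φ b (r • c) • n
      rw [κ.φ_bal]
  exact DFunLike.congr_fun h y

/-- The map `b ⊗ (c ⊗ n) ↦ φ(b, c) n`. -/
def evalLeft : B.tensorLeftObj (C.tensorLeftObj N) →+ N :=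
  BalTensor.lift (M := B) (N := C.tensorLeftObj N) (κ.pairLeft N) (κ.pairLeft_smul N)

theorem evalLeft_triple (b : B) (c : C) (n : N) :
    κ.evalLeft N (tripleLeft N b c n) = κ.φ b c • n := rfl

/-- Mirror image of `evalRight_injective`: the scalar `s` is now inserted at the outer left factor
`b`. -/
theorem evalLeft_injective : Function.Injective (κ.evalLeft N) := by
  have key : ∀ s ∈ AddSubgroup.closure {x | ∃ b c, κ.φ b c = x},
      ∃ g : N →+ B.tensorLeftObj (C.tensorLeftObj N), ∀ b c n,
        tripleLeft N (s • b) c n = g (κ.φ b c • n) := by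
    intro s hs
    have badd : ∀ b b' c n, tripleLeft (B := B) (C := C) N (b + b') c n =
        tripleLeft N b c n + tripleLeft N b' c n := fun b b' c n =>
      BalTensor.add_tmul (M := B) (N := C.tensorLeftObj N) R b b' _
    let t (c : C) (n : N) : B →+ B.tensorLeftObj (C.tensorLeftObj N) :=
      AddMonoidHom.mk' (fun b => tripleLeft N b c n) (fun b b' => badd b b' c n)
    induction hs using AddSubgroup.closure_induction with
    | mem s hs =>
      obtain ⟨b', c', rfl⟩ := hs
      -- For `s = φ(b', c')` take `g n = b' ⊗ (c' ⊗ n)`. Then `φ(b', c') b ⊗ (c ⊗ n) = b' ψ(c', b) ⊗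
      -- (c ⊗ n) = b' ⊗ (ψ(c', b) c ⊗ n) = b' ⊗ (c' φ(b, c) ⊗ n) = b' ⊗ (c' ⊗ φ(b, c) n)`.
      refine ⟨AddMonoidHom.mk' (fun n => tripleLeft N b' c' n) (fun n n' => ?_),
        fun b c n => ?_⟩
      · refine Eq.trans ?_ (BalTensor.tmul_add (M := B) (N := C.tensorLeftObj N) R b' _ _)
        exact congrArg (fun y => BalTensor.tmul (M := B) (N := C.tensorLeftObj N) R b' y)
          (BalTensor.tmul_add S c' n n')
      · rw [κ.φψ]
        refine (BalTensor.smul_tmul (M := B) (N := C.tensorLeftObj N) R b' (κ.ψ c' b) _).trans ?_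
        refine congrArg (fun y => BalTensor.tmul (M := B) (N := C.tensorLeftObj N) R b' y) ?_
        change BalTensor.tmul S (κ.ψ c' b • c) n = BalTensor.tmul S c' (κ.φ b c • n)
        rw [κ.ψφ, BalTensor.smul_tmul]
    | zero => exact ⟨0, fun b c n => by rw [zero_smul]; exact map_zero (t c n)⟩
    | add s s' _ _ hs hs' =>
      obtain ⟨g, hg⟩ := hs
      obtain ⟨g', hg'⟩ := hs'
      exact ⟨g + g', fun b c n => by
        rw [add_smul, badd, hg, hg', AddMonoidHom.add_apply]⟩
    | neg s _ hs =>
      obtain ⟨g, hg⟩ := hs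
      exact ⟨-g, fun b c n => by
        rw [neg_smul, AddMonoidHom.neg_apply, ← hg]
        exact map_neg (t c n) _⟩
  obtain ⟨g, hg⟩ := key 1 κ.φ_one
  refine Function.LeftInverse.injective (g := g) fun x => ?_
  induction x using tripleLeft_induction with
  | pure b c n => rw [evalLeft_triple, ← hg, one_smul]
  | hadd x y hx hy => rw [map_add, map_add, hx, hy]

theorem evalLeft_surjective : Function.Surjective (κ.evalLeft N) := by
  intro n
  have key : ∀ s ∈ AddSubgroup.closure {x | ∃ b c, κ.φ b c = x},
      s • n ∈ (κ.evalLeft N).range := by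
    intro s hs
    induction hs using AddSubgroup.closure_induction with
    | mem s hs =>
      obtain ⟨b, c, rfl⟩ := hs
      exact ⟨tripleLeft N b c n, rfl⟩
    | zero => simp
    | add s s' _ _ hs hs' => rw [add_smul]; exact add_mem hs hs'
    | neg s _ hs => rw [neg_smul]; exact neg_mem hs
  simpa using key 1 κ.φ_one

/-- `evalLeft` as a morphism of supermodules. -/
def evalLeftHom : B.tensorLeftObj (C.tensorLeftObj N) ⟶ N where
  toLin :=
    { κ.evalLeft N with
      map_smul' := fun s x => by
        change κ.evalLeft N (s • x) = s • κ.evalLeft N x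
        induction x using tripleLeft_induction with
        | pure b c n =>
          change κ.φ (s • b) c • n = s • κ.φ b c • n
          rw [κ.φ_smul, mul_smul]
        | hadd x y hx hy => rw [smul_add, map_add, map_add, smul_add, hx, hy] }
  map_mem k x hx := by
    refine BalTensor.map_mem_tensorGrading (M := B) (N := C.tensorLeftObj N)
      (𝓝 := (C.tensorLeftObj N).grading) (κ.evalLeft N) ?_ hx
    rintro i j b y rfl hb hy
    refine BalTensor.map_mem_tensorGrading (M := C) (N := N) (𝓖 := N.grading (i + j))
      ((κ.evalLeft N).comp (BalTensor.tmulHom (M := B) (N := C.tensorLeftObj N) R b)) ?_ hy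
    rintro k l c n rfl hc hn
    change κ.φ b c • n ∈ _
    have h := N.smul_mem (κ.φ_mem hb hc) hn
    rwa [add_assoc] at h

end Left

/-- Tensoring left supermodules with `C` and then with `B` is the identity. -/
noncomputable def tensorLeftIso : C.tensorLeft ⋙ B.tensorLeft ≅ 𝟭 (LeftSuperMod 𝓢) :=
  NatIso.ofComponents
    (fun N => SuperMod.isoOfBijective (κ.evalLeftHom N)
      ⟨κ.evalLeft_injective N, κ.evalLeft_surjective N⟩)
    (fun {M N} f => SuperMod.Hom.ext (LinearMap.ext fun x => by
      change κ.evalLeft N (((C.tensorLeft ⋙ B.tensorLeft).map f).toLin x) =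
        f.toLin (κ.evalLeft M x)
      refine tripleLeft_induction (p := fun x =>
        κ.evalLeft N (((C.tensorLeft ⋙ B.tensorLeft).map f).toLin x) =
          f.toLin (κ.evalLeft M x)) x (fun b c n => ?_) (fun x y hx hy => ?_)
      · change κ.φ b c • f.toLin n = f.toLin (κ.φ b c • n)
        rw [map_smul]
      · refine (map_add ((κ.evalLeft N).comp
          ((C.tensorLeft ⋙ B.tensorLeft).map f).toLin.toAddMonoidHom) x y).trans ?_
        rw [map_add, map_add]
        exact congrArg₂ (· + ·) hx hy))

end SuperMorita

/-! ### The Morita context of a progenerator -/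

namespace RightSuperMod

variable {R : Type u} [Ring R] {𝓡 : ZMod 2 → AddSubgroup R}

section

variable (P : RightSuperMod 𝓡)

/-- The endomorphism `x ↦ p q(x)`. -/
def rankOne : P →+ Dual P →+ EndRing P :=
  AddMonoidHom.mk' (fun p => AddMonoidHom.mk' (fun q =>
      { toFun := fun x => op (q x) • p
        map_add' := fun x y => by rw [map_add, MulOpposite.op_add, add_smul]
        map_smul' := fun r x => by
          rw [map_smul, RingHom.id_apply, ← mul_smul]
          rfl })
      (fun q q' => LinearMap.ext fun x => add_smul (op (q x)) (op (q' x)) p))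
    (fun p p' => by ext q x; exact smul_add (op (q x)) p p')

/-- The evaluation pairing. -/
def evalPairing : Dual P →+ P →+ R :=
  AddMonoidHom.mk' (fun q => q.toAddMonoidHom) (fun _ _ => rfl)

variable {P}

/-- The homogeneous components of a finite generating set still generate. Homogeneity makes the
covering map from a graded free module parity-preserving, as graded projectivity requires. -/
theorem exists_homogeneous_generators (hP : Module.Finite Rᵐᵒᵖ P) :
    ∃ (n : ℕ) (g : Fin n × ZMod 2 → P), (∀ i, g i ∈ P.grading i.2) ∧
      Submodule.span Rᵐᵒᵖ (Set.range g) = ⊤ := by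
  obtain ⟨n, s, hs⟩ := Module.Finite.exists_fin (R := Rᵐᵒᵖ) (M := P)
  refine ⟨n, fun i => gradeProj P.isInternal i.2 (s i.1),
    fun i => gradeProj_mem P.isInternal _ _, ?_⟩
  rw [eq_top_iff, ← hs, Submodule.span_le]
  rintro _ ⟨i, rfl⟩
  rw [SetLike.mem_coe, ← sum_gradeProj P.isInternal (s i)]
  exact sum_mem fun k _ => Submodule.subset_span ⟨(i, k), rfl⟩

end

/-! ### Dual bases and the trace ideal -/

variable [GradedRing 𝓡]

variable (𝓡) in
/-- The free right supermodule on homogeneous generators of degrees `d i`. -/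
def free {ι : Type} (d : ι → ZMod 2) : RightSuperMod 𝓡 where
  carrier := ι → R
  grading k :=
    -- The shift by `d i` puts the `i`-th basis vector, whose coefficient `1` has degree `0` in `R`,
    -- in degree `d i`.
    { carrier := {f | ∀ i, f i ∈ 𝓡 (k - d i)}
      zero_mem' := fun _ => zero_mem _
      add_mem' := fun hf hg i => add_mem (hf i) (hg i)
      neg_mem' := fun hf i => neg_mem (hf i) }
  isInternal := by
    have hR := DirectSum.Decomposition.isInternal 𝓡
    refine isInternal_of_proj (fun k => AddMonoidHom.mk'
      (fun f i => gradeProj hR (k - d i) (f i)) fun f g => funext fun i => map_add _ _ _) ?_ ?_ ?_ ?_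
    · intro k f i
      exact gradeProj_mem hR _ _
    · intro k f hf
      exact funext fun i => gradeProj_same hR (hf i)
    · intro j k f hjk hf
      exact funext fun i => gradeProj_ne hR (hf i) fun e => hjk (sub_left_injective e)
    · intro f
      funext i
      rw [Finset.sum_apply]
      exact (Fintype.sum_equiv (Equiv.subRight (d i)) _ (fun k => gradeProj hR k (f i))
        (fun _ => rfl)).trans (sum_gradeProj hR (f i))
  smul_mem {i j a f} ha hf l := by
    have h := SetLike.mul_mem_graded (hf l) (mem_opGrading.1 ha)
    rwa [sub_add_eq_add_sub, add_comm j i] at h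

variable (𝓡) in
/-- The ring `R` as a right supermodule over itself. -/
def regular : RightSuperMod 𝓡 where
  carrier := R
  grading := 𝓡
  isInternal := DirectSum.Decomposition.isInternal 𝓡
  smul_mem {i j a r} ha hr := by
    have h := SetLike.mul_mem_graded hr (mem_opGrading.1 ha)
    rwa [add_comm] at h

variable {P : RightSuperMod 𝓡}

/-- The dual basis property: the identity of a finitely generated projective is a sum of
endomorphisms of the form `x ↦ p q(x)`. -/
theorem one_mem_closure_rankOne (hfin : Module.Finite Rᵐᵒᵖ P) (hproj : SuperMod.IsProjective P) :
    (1 : EndRing P) ∈ AddSubgroup.closure {x | ∃ p q, rankOne P p q = x} := by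
  obtain ⟨n, g, hg, hspan⟩ := exists_homogeneous_generators hfin
  -- The graded free module has one basis vector for each homogeneous generator, of the same degree,
  -- so that `π` is even.
  let π : free 𝓡 (fun i : Fin n × ZMod 2 => i.2) ⟶ P :=
    { toLin :=
        { toFun := fun f : Fin n × ZMod 2 → R => ∑ i, op (f i) • g i
          map_add' := fun f f' => by
            rw [← Finset.sum_add_distrib]
            exact Finset.sum_congr rfl fun i _ => add_smul (op (f i)) (op (f' i)) (g i)
          map_smul' := fun r f => by
            rw [RingHom.id_apply, Finset.smul_sum]
            exact Finset.sum_congr rfl fun i _ => mul_smul r (op (f i)) (g i) }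
      map_mem := fun k f hf => sum_mem fun i _ => by
        have h := P.smul_mem (mem_opGrading.2 (hf i : unop (op (f i)) ∈ _)) (hg i)
        rwa [sub_add_cancel] at h }
  have hπ : Function.Surjective π.toLin := by
    rw [← LinearMap.range_eq_top, eq_top_iff, ← hspan, Submodule.span_le]
    rintro _ ⟨i, rfl⟩
    refine ⟨(Pi.single i 1 : Fin n × ZMod 2 → R), ?_⟩
    change ∑ j, op ((Pi.single i 1 : Fin n × ZMod 2 → R) j) • g j = g i
    rw [Finset.sum_eq_single i]
    · simp
    · intro j _ hj
      simp [Pi.single_eq_of_ne hj]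
    · simp
  obtain ⟨h, hh⟩ := hproj.exists_section π hπ
  -- The coordinates of the section form the dual basis: `x = π (h x)` reads `x = ∑ g i q i(x)`.
  let q (i : Fin n × ZMod 2) : Dual P :=
    { toFun := fun x => (h x : Fin n × ZMod 2 → R) i
      map_add' := fun x y => by rw [map_add]; rfl
      map_smul' := fun r x => by rw [map_smul]; rfl }
  have e : (1 : EndRing P) = ∑ i, rankOne P (g i) (q i) := by
    ext x
    rw [LinearMap.sum_apply]
    exact (hh x).symm
  rw [e]
  exact sum_mem fun i _ => AddSubgroup.subset_closure ⟨_, _, rfl⟩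

-- From `q(p) r = q(p r)`: this is what makes the trace subgroup a right ideal.
omit [GradedRing 𝓡] in
theorem mul_mem_closure_evalPairing (r x : R)
    (hx : x ∈ AddSubgroup.closure {x : R | ∃ q p, evalPairing P q p = x}) :
    x * r ∈ AddSubgroup.closure {x : R | ∃ q p, evalPairing P q p = x} := by
  induction hx using AddSubgroup.closure_induction with
  | mem x hx =>
    obtain ⟨q, p, rfl⟩ := hx
    exact AddSubgroup.subset_closure ⟨q, op r • p, map_smul q (op r) p⟩
  | zero => rw [zero_mul]; exact zero_mem _
  | add x y _ _ hx hy => rw [add_mul]; exact add_mem hx hy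
  | neg x _ hx => rw [neg_mul]; exact neg_mem hx

variable (P) in
/-- The trace ideal, generated by the values of linear maps `P → R`. -/
def traceIdeal : Submodule Rᵐᵒᵖ (regular 𝓡) :=
  { AddSubgroup.closure {x : R | ∃ q p, evalPairing P q p = x} with
    smul_mem' := fun r x hx => mul_mem_closure_evalPairing (P := P) (unop r) x hx }

/-- Both `q` and `p` split into homogeneous parts, and `q(p)` is homogeneous when they are. It
follows that `R` modulo the trace ideal is a supermodule, on which the generator hypothesis can be
tested. -/
theorem gradeProj_mem_closure_evalPairing (k : ZMod 2) (x : R)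
    (hx : x ∈ AddSubgroup.closure {x : R | ∃ q p, evalPairing P q p = x}) :
    gradeProj (DirectSum.Decomposition.isInternal 𝓡) k x ∈
      AddSubgroup.closure {x : R | ∃ q p, evalPairing P q p = x} := by
  induction hx using AddSubgroup.closure_induction with
  | mem x hx =>
    obtain ⟨q, p, rfl⟩ := hx
    induction q using grade_induction P.dualBimod.isInternal with
    | hadd q q' hq hq' =>
      rw [map_add, AddMonoidHom.add_apply, map_add]
      exact add_mem hq hq'
    | hom i q hq =>
      induction p using grade_induction P.isInternal with
      | hadd p p' hp hp' =>
        rw [map_add, map_add]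
        exact add_mem hp hp'
      | hom j p hp =>
        have hqp : evalPairing P q p ∈ 𝓡 (j + i) := hq j p hp
        by_cases h : j + i = k
        · subst h
          rw [gradeProj_same _ hqp]
          exact AddSubgroup.subset_closure ⟨q, p, rfl⟩
        · rw [gradeProj_ne _ hqp h]
          exact zero_mem _
  | zero => rw [map_zero]; exact zero_mem _
  | add x y _ _ hx hy => rw [map_add]; exact add_mem hx hy
  | neg x _ hx => rw [map_neg]; exact neg_mem hx

/-- Let `T` be the trace ideal. Every linear map `P → R` takes values in `T`, so it dies after
composition with `R → R / T`. As `P` is a generator, that quotient map is zero, and its value at `1`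
gives `1 ∈ T`. -/
theorem IsGenerator.one_mem_closure_evalPairing (hP : IsGenerator P) :
    (1 : R) ∈ AddSubgroup.closure {x | ∃ q p, evalPairing P q p = x} := by
  have h := hP _ _ ((regular 𝓡).quotientMk (traceIdeal P)
    fun k x hx => gradeProj_mem_closure_evalPairing (𝓡 := 𝓡) (P := P) k x hx) fun q =>
    LinearMap.ext fun p => (Submodule.Quotient.mk_eq_zero (traceIdeal P)).2
      (AddSubgroup.subset_closure ⟨q, p, rfl⟩)
  exact (Submodule.Quotient.mk_eq_zero (traceIdeal P)).1
    (LinearMap.congr_fun (congrArg SuperMod.Hom.toLin h) (1 : R))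

/-- The Morita context of a progenerator. -/
def IsProgenerator.superMorita (hP : P.IsProgenerator) :
    SuperMorita P.selfBimod P.dualBimod where
  φ := rankOne P
  ψ := evalPairing P
  φ_smul s p q := LinearMap.ext fun x => (map_smul s (op (q x)) p).symm
  φ_op_smul _ _ _ := rfl
  φ_bal r p q := LinearMap.ext fun x => (mul_smul (op (q x)) (op r) p).symm
  φ_mem {i j p q} hp hq l x hx := by
    have h := P.smul_mem (mem_opGrading.2 (hq l x hx : unop (op (q x)) ∈ _)) hp
    rwa [add_assoc, add_comm j i] at h
  ψ_smul _ _ _ := rfl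
  ψ_op_smul r q p := map_smul q (op r) p
  ψ_bal _ _ _ := rfl
  ψ_mem {i j q p} hq hp := by
    have h := hq j p hp
    rwa [add_comm] at h
  φψ _ _ _ := rfl
  -- At `x` this reads `q(p) q'(x) = q(p q'(x))`, the `R`-linearity of `q`; the other associativity
  -- law holds by definition.
  ψφ q p q' := LinearMap.ext fun x => (map_smul q (op (q' x)) p).symm
  φ_one := one_mem_closure_rankOne hP.finite hP.projective
  ψ_one := hP.generator.one_mem_closure_evalPairing

end RightSuperMod

/-! ### The two equivalences -/

theorem mutuallyInverseEquivalences_of_iso {C D : Type*} [Category C] [Category D] {F : C ⥤ D}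
    {G : D ⥤ C} (η : F ⋙ G ≅ 𝟭 C) (ε : G ⋙ F ≅ 𝟭 D) : MutuallyInverseEquivalences F G :=
  ⟨(CategoryTheory.Equivalence.mk F G η.symm ε).isEquivalence_functor,
    (CategoryTheory.Equivalence.mk F G η.symm ε).isEquivalence_inverse, ⟨η⟩, ⟨ε⟩⟩

/-- One Morita context yields all four isomorphisms. Those over `S` rest on the dual basis; those
over `R` come from the exchanged context and rest on the trace ideal. -/
theorem theorem3p2p1 {R : Type u} [Ring R] (𝓡 : ZMod 2 → AddSubgroup R) [GradedRing 𝓡]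
    (P : RightSuperMod 𝓡) (hP : P.IsProgenerator) :
    MutuallyInverseEquivalences P.dualBimod.tensorRight P.selfBimod.tensorRight ∧
      MutuallyInverseEquivalences P.selfBimod.tensorLeft P.dualBimod.tensorLeft :=
  ⟨mutuallyInverseEquivalences_of_iso hP.superMorita.symm.tensorRightIso
      hP.superMorita.tensorRightIso,
    mutuallyInverseEquivalences_of_iso hP.superMorita.symm.tensorLeftIso
      hP.superMorita.tensorLeftIso⟩
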